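/- Let $G$ be a finite simple undirected graph that is 2-connected, i.e. $G$ has at least three vertices, is connected, and remains connected after the deletion of any one vertex. Let $l$ be the length (number of edges) of a longest path in $G$, and let $c$ be the circumference of $G$, i.e. the length of a longest cycle in $G$. Then $$c \ge 2\sqrt{l}.$$ -/

import Mathlib

/-!
Given a path `p` of length `l ≥ 2`, 2-connectedness lets us cover it greedily by ears (paths off
`p` that jump over a stretch of `p`), each chosen to reach as far along `p` as possible. Maximality
keeps the ears disjoint away from `p`, so for `i < j` the ears `i, …, j - 1` and the stretches of
`p` covered once close up to a cycle containing the overlaps `o i` and `o j` as well as all the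
gaps between overlaps `i` and `j`. If `c` bounds the length of all cycles, this gives
`o i + ∑ t ∈ [i, j), (g t + 1) + o j ≤ c`, the `+ 1` coming from the ears themselves.
The path is the disjoint union of its overlaps and gaps. Pairing the overlap `i` with the overlap
`m - i` and adding up `n` of these inequalities gives `l + n ^ 2 ≤ n * c`, hence `4 * l ≤ c ^ 2`.
-/

namespace SimpleGraph

variable {V : Type*}

/-- A graph is `k`-connected if it has more than `k` vertices and deleting any set of fewer
than `k` vertices leaves a connected graph. -/
def IsKVertexConnected (G : SimpleGraph V) (k : ℕ) : Prop :=
  (k : ℕ∞) < ENat.card V ∧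
    ∀ X : Finset V, X.card < k → (G.induce ((X : Set V)ᶜ)).Connected

/-- The set of lengths (numbers of edges) of paths of `G`. -/
def pathLengths (G : SimpleGraph V) : Set ℕ :=
  {n | ∃ (u v : V) (p : G.Walk u v), p.IsPath ∧ p.length = n}

/-- The set of lengths (numbers of edges) of cycles of `G`. -/
def cycleLengths (G : SimpleGraph V) : Set ℕ :=
  {n | ∃ (u : V) (p : G.Walk u u), p.IsCycle ∧ p.length = n}

/-- The length of a longest path of a finite nonempty graph. -/
noncomputable def longestPathLength (G : SimpleGraph V) : ℕ :=
  sSup G.pathLengths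

/-- The circumference of a finite graph: the length of a longest cycle
(and `0` if there is no cycle). -/
noncomputable def circumference (G : SimpleGraph V) : ℕ :=
  sSup G.cycleLengths

/-- In a finite nonempty graph `longestPathLength` is attained and is the maximum. -/
theorem isGreatest_longestPathLength [Finite V] [Nonempty V] (G : SimpleGraph V) :
    IsGreatest G.pathLengths G.longestPathLength := by
  have := Fintype.ofFinite V
  have hb : BddAbove G.pathLengths := by
    refine ⟨Fintype.card V, ?_⟩
    rintro n ⟨u, v, p, hp, rfl⟩
    exact hp.length_lt.le
  have hn : G.pathLengths.Nonempty :=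
    ⟨0, Classical.arbitrary V, _, Walk.nil, Walk.IsPath.nil, rfl⟩
  exact ⟨Nat.sSup_mem hn hb, fun n h => le_csSup hb h⟩

/-- In a finite graph that contains a cycle, `circumference` is attained and is the maximum. -/
theorem isGreatest_circumference [Finite V] (G : SimpleGraph V) (h : ¬ G.IsAcyclic) :
    IsGreatest G.cycleLengths G.circumference := by
  have := Fintype.ofFinite V
  have hb : BddAbove G.cycleLengths := by
    refine ⟨Fintype.card V, ?_⟩
    rintro n ⟨u, p, hp, rfl⟩
    have h1 := hp.support_nodup.length_le_card
    simpa using h1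
  have hn : G.cycleLengths.Nonempty := by
    simp only [IsAcyclic, not_forall, not_not] at h
    obtain ⟨u, p, hp⟩ := h
    exact ⟨_, u, p, hp, rfl⟩
  exact ⟨Nat.sSup_mem hn hb, fun n h => le_csSup hb h⟩

end SimpleGraph

section

open SimpleGraph

variable {V : Type*} {G : SimpleGraph V} {u v w : V}

section Walks

theorem isPath_append_of_inter {p : G.Walk u v} {q : G.Walk v w} (hp : p.IsPath) (hq : q.IsPath)
    (h : ∀ x ∈ p.support, x ∈ q.support → x = v) : (p.append q).IsPath := by
  have hv : v ∉ q.support.tail := (List.nodup_cons.mp (q.cons_tail_support ▸ hq.support_nodup)).1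
  rw [Walk.isPath_def, Walk.support_append, List.nodup_append']
  exact ⟨hp.support_nodup, hq.support_nodup.tail,
    fun x hx hx' => hv (h x hx (List.mem_of_mem_tail hx') ▸ hx')⟩

theorem isCycle_append_of_inter {p : G.Walk u v} {q : G.Walk v u} (hp : p.IsPath)
    (hq : q.IsPath) (h : ∀ x ∈ p.support, x ∈ q.support → x = u ∨ x = v)
    (hlen : 1 < p.length ∨ 1 < q.length) : (p.append q).IsCycle := by
  have hu : u ∉ p.support.tail := (List.nodup_cons.mp (p.cons_tail_support ▸ hp.support_nodup)).1
  have hv : v ∉ q.support.tail := (List.nodup_cons.mp (q.cons_tail_support ▸ hq.support_nodup)).1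
  refine hp.isCycle_append hq (fun x hxp hxq => ?_) hlen
  rcases h x (List.mem_of_mem_tail hxp) (List.mem_of_mem_tail hxq) with rfl | rfl
  exacts [hu hxp, hv hxq]

theorem exists_isPath_getVert_getVert {p : G.Walk u v} (hp : p.IsPath) {i j : ℕ} (hij : i ≤ j)
    (hj : j ≤ p.length) :
    ∃ q : G.Walk (p.getVert i) (p.getVert j), q.IsPath ∧ q.length = j - i ∧
      ∀ x ∈ q.support, ∃ k, i ≤ k ∧ k ≤ j ∧ x = p.getVert k := by
  have hend : (p.drop i).getVert (j - i) = p.getVert j := by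
    rw [Walk.drop_getVert, Nat.add_sub_cancel' hij]
  refine ⟨((p.drop i).take (j - i)).copy rfl hend, ?_, ?_, fun x hx => ?_⟩
  · exact (Walk.isPath_copy ..).mpr ((hp.drop i).take _)
  · rw [Walk.length_copy, Walk.take_length, Walk.drop_length]
    omega
  · rw [Walk.support_copy, Walk.mem_support_iff_exists_getVert] at hx
    obtain ⟨n, rfl, hn⟩ := hx
    rw [Walk.take_length, Walk.drop_length] at hn
    rw [Walk.take_getVert, Walk.drop_getVert]
    exact ⟨_, Nat.le_add_right .., by omega, rfl⟩

end Walks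

section JoinedOff

/-- The vertices `u` and `v` are joined in `G` by a walk that meets `S` at most in `u` and `v`. -/
def JoinedOff (G : SimpleGraph V) (S : Set V) (u v : V) : Prop :=
  ∃ q : G.Walk u v, ∀ x ∈ q.support, x ∈ S → x = u ∨ x = v

variable {S : Set V}

theorem joinedOff_refl (u : V) : JoinedOff G S u u :=
  ⟨.nil, fun _ hx _ => .inl (Walk.mem_support_nil_iff.mp hx)⟩

theorem joinedOff_of_adj (h : G.Adj u v) : JoinedOff G S u v :=
  ⟨h.toWalk, fun _ hx _ => by simpa using hx⟩

theorem JoinedOff.symm (h : JoinedOff G S u v) : JoinedOff G S v u := by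
  obtain ⟨q, hq⟩ := h
  exact ⟨q.reverse, fun x hx hxS => (hq x (by simpa using hx) hxS).symm⟩

theorem JoinedOff.trans (huv : JoinedOff G S u v) (hv : v ∉ S) (hvw : JoinedOff G S v w) :
    JoinedOff G S u w := by
  obtain ⟨q, hq⟩ := huv
  obtain ⟨r, hr⟩ := hvw
  refine ⟨q.append r, fun x hx hxS => ?_⟩
  have hxv : x ≠ v := fun h => hv (h ▸ hxS)
  rcases (Walk.mem_support_append_iff ..).mp hx with hx | hx
  · exact .inl ((hq x hx hxS).resolve_right hxv)
  · exact .inr ((hr x hx hxS).resolve_left hxv)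

theorem joinedOff_of_mem_support {q : G.Walk u v} (hq : q.IsPath)
    (hoff : ∀ x ∈ q.support, x ∈ S → x = u ∨ x = v) (hw : w ∈ q.support) (hvw : v ≠ w) :
    JoinedOff G S u w := by
  classical
  refine ⟨q.takeUntil w hw, fun x hx hxS => .inl ?_⟩
  have hxv : x ≠ v := fun h => Walk.endpoint_notMem_support_takeUntil hq hw hvw (h ▸ hx)
  exact (hoff x (q.support_takeUntil_subset_support hw hx) hxS).resolve_right hxv

theorem JoinedOff.exists_isPath (h : JoinedOff G S u v) (hu : u ∈ S) (hv : v ∈ S) :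
    ∃ q : G.Walk u v, q.IsPath ∧ ∀ x ∈ q.support,
      x = u ∨ x = v ∨ x ∉ S ∧ JoinedOff G S u x ∧ JoinedOff G S x v := by
  classical
  obtain ⟨q, hq⟩ := h
  have hoff : ∀ x ∈ q.bypass.support, x ∈ S → x = u ∨ x = v :=
    fun x hx => hq x (q.support_bypass_subset_support hx)
  have hoff' : ∀ x ∈ q.bypass.reverse.support, x ∈ S → x = v ∨ x = u :=
    fun x hx hxS => (hoff x (by simpa using hx) hxS).symm
  refine ⟨q.bypass, q.bypass_isPath, fun x hx => ?_⟩
  by_cases hxS : x ∈ S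
  · exact (hoff x hx hxS).imp_right .inl
  · exact .inr (.inr ⟨hxS,
      joinedOff_of_mem_support q.bypass_isPath hoff hx (ne_of_mem_of_not_mem hv hxS),
      (joinedOff_of_mem_support q.bypass_isPath.reverse hoff' (by simpa using hx)
        (ne_of_mem_of_not_mem hu hxS)).symm⟩)

theorem exists_joinedOff_of_walk {A B : Set V} {a : V} (ha : a ∈ A) (hv : v ∈ B)
    (hau : JoinedOff G S a u) (r : G.Walk u v) (hr : ∀ x ∈ r.support, x ∈ S → x ∈ A ∨ x ∈ B) :
    ∃ a ∈ A, ∃ b ∈ B, JoinedOff G S a b := by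
  induction r generalizing a with
  | nil => exact ⟨a, ha, _, hv, hau⟩
  | @cons u w v huw r ih =>
    have hr' : ∀ x ∈ r.support, x ∈ S → x ∈ A ∨ x ∈ B := fun x hx => hr x (by simp [hx])
    by_cases huS : u ∈ S
    · rcases hr u (by simp) huS with huA | huB
      · exact ih huA hv (joinedOff_of_adj huw) hr'
      · exact ⟨a, ha, u, huB, hau⟩
    · exact ih ha hv (hau.trans huS (joinedOff_of_adj huw)) hr'

end JoinedOff

section Ears

/-- The positions on the walk `p` at which an ear of `p` starting at position `i` can end. A single
edge between two vertices of `p` counts as an ear, even if it is an edge of `p`. -/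
def earEnds (p : G.Walk u v) (i : ℕ) : Set ℕ :=
  {j | j ≤ p.length ∧ JoinedOff G {x | x ∈ p.support} (p.getVert i) (p.getVert j)}

variable {p : G.Walk u v} {k : ℕ}

theorem exists_mem_earEnds_of_preconnected_compl (hp : p.IsPath) (hk0 : 0 < k)
    (hk : k < p.length) (hconn : (G.induce {p.getVert k}ᶜ).Preconnected) :
    ∃ i < k, ∃ j ∈ earEnds p i, k < j := by
  have hne : ∀ i ≤ p.length, i ≠ k → p.getVert i ∈ ({p.getVert k}ᶜ : Set V) :=
    fun i hi hik h => hik (hp.getVert_injOn hi hk.le h)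
  obtain ⟨r⟩ := hconn ⟨_, hne 0 (Nat.zero_le _) hk0.ne⟩ ⟨_, hne p.length le_rfl hk.ne'⟩
  let A : Set V := p.getVert '' {i | i < k}
  let B : Set V := p.getVert '' {j | k < j ∧ j ≤ p.length}
  have hr : ∀ x ∈ (r.map (Embedding.induce _).toHom).support, x ∈ p.support → x ∈ A ∨ x ∈ B := by
    intro x hx hxp
    rw [Walk.support_map, List.mem_map] at hx
    obtain ⟨⟨x, hxk⟩, -, rfl⟩ := hx
    obtain ⟨i, rfl, hi⟩ := Walk.mem_support_iff_exists_getVert.mp hxp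
    rcases lt_trichotomy i k with hik | rfl | hki
    exacts [.inl ⟨i, hik, rfl⟩, (hxk rfl).elim, .inr ⟨i, ⟨hki, hi⟩, rfl⟩]
  obtain ⟨_, ⟨i, hi, rfl⟩, _, ⟨j, ⟨hkj, hj⟩, rfl⟩, hij⟩ :=
    exists_joinedOff_of_walk (A := A) (B := B) ⟨0, hk0, rfl⟩ ⟨p.length, ⟨hk, le_rfl⟩, rfl⟩
      (joinedOff_refl _) _ hr
  exact ⟨i, hi, j, ⟨hj, hij⟩, hkj⟩

theorem exists_mem_earEnds_forall_le (hp : p.IsPath) (hk0 : 0 < k) (hk : k < p.length)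
    (hconn : (G.induce {p.getVert k}ᶜ).Preconnected) :
    ∃ i < k, ∃ j ∈ earEnds p i, k < j ∧ ∀ i' < k, ∀ z ∈ earEnds p i', z ≤ j := by
  obtain ⟨i, hi, j, hj, hkj⟩ := exists_mem_earEnds_of_preconnected_compl hp hk0 hk hconn
  let E : Set ℕ := {z | ∃ i < k, z ∈ earEnds p i}
  have hbdd : BddAbove E := ⟨p.length, fun _ ⟨_, _, hz⟩ => hz.1⟩
  obtain ⟨i₀, hi₀, hmem⟩ : sSup E ∈ E := Nat.sSup_mem ⟨j, i, hi, hj⟩ hbdd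
  exact ⟨i₀, hi₀, sSup E, hmem, hkj.trans_le (le_csSup hbdd ⟨i, hi, hj⟩),
    fun i' hi' z hz => le_csSup hbdd ⟨i', hi', hz⟩⟩

end Ears

section Vines

/-- A vine on the walk `p` from position `k` on: the `t`-th ear, for `t < numEars`, starts at
position `left t` and ends at position `right (t + 1)`, as far along `p` as any ear with that
start. Consecutive ears overlap in the segment from `left t` to `right t`; by convention
`right 0 = k`, and the last overlap is the last edge of `p`. -/
structure Vine (p : G.Walk u v) (k : ℕ) where
  numEars : ℕ
  left : ℕ → ℕ
  right : ℕ → ℕ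
  right_zero : right 0 = k
  left_last : left numEars + 1 = p.length
  right_last : right numEars = p.length
  left_lt_right : ∀ t ≤ numEars, left t < right t
  right_le_left : ∀ t < numEars, right t ≤ left (t + 1)
  isGreatest : ∀ t < numEars, IsGreatest (earEnds p (left t)) (right (t + 1))

variable {p : G.Walk u v} {k : ℕ}

theorem Vine.right_lt_right (W : Vine p k) {t : ℕ} (ht : t < W.numEars) :
    W.right t < W.right (t + 1) :=
  (W.right_le_left t ht).trans_lt (W.left_lt_right (t + 1) ht)

theorem Vine.le_left_zero {j : ℕ} (W : Vine p j) (hk : k < p.length)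
    (hmax : ∀ i < k, ∀ z ∈ earEnds p i, z ≤ j) : k ≤ W.left 0 := by
  rcases Nat.eq_zero_or_pos W.numEars with hm | hm
  · have hlast := W.left_last
    rw [hm] at hlast
    omega
  · by_contra! hlt
    have hle := hmax _ hlt _ (W.isGreatest 0 hm).1
    exact (W.right_lt_right hm).not_ge (hle.trans W.right_zero.ge)

theorem nonempty_vine (hp : p.IsPath) (hconn : ∀ x, (G.induce {x}ᶜ).Preconnected) (hk0 : 0 < k)
    (hk : k ≤ p.length) : Nonempty (Vine p k) := by
  induction hd : p.length - k using Nat.strong_induction_on generalizing k with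
  | _ d ih =>
    rcases hk.eq_or_lt with rfl | hk
    · exact ⟨⟨0, fun _ => p.length - 1, fun _ => p.length, rfl, by omega, rfl,
        by omega, by omega, by omega⟩⟩
    obtain ⟨i, hi, j, hj, hkj, hmax⟩ := exists_mem_earEnds_forall_le hp hk0 hk (hconn _)
    obtain ⟨W⟩ := ih _ (by omega) (by omega) hj.1 rfl
    exact ⟨{
      numEars := W.numEars + 1
      left := fun t => t.casesOn i W.left
      right := fun t => t.casesOn k W.right
      right_zero := rfl
      left_last := W.left_last
      right_last := W.right_last
      left_lt_right := by
        rintro (_ | t) ht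
        exacts [hi, W.left_lt_right t (by omega)]
      right_le_left := by
        rintro (_ | t) ht
        exacts [W.le_left_zero hk hmax, W.right_le_left t (by omega)]
      isGreatest := by
        rintro (_ | t) ht
        · exact (congrArg (IsGreatest (earEnds p i)) W.right_zero).mpr ⟨hj, hmax i hi⟩
        · exact W.isGreatest t (by omega) }⟩

end Vines

section PartialCycles

variable {p : G.Walk u v} {x y b n s : ℕ}

/-- The vertices that a later ear, starting at or after position `x` and ending beyond position
`y`, can meet only in its start: those of `p` up to position `x`, and those off `p` from which no
ear leads beyond position `y`. -/
def behind (p : G.Walk u v) (x y : ℕ) : Set V :=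
  {w | (∃ i ≤ x, w = p.getVert i) ∨
    w ∉ p.support ∧ ∀ z ≤ p.length, JoinedOff G {a | a ∈ p.support} w (p.getVert z) → z ≤ y}

theorem behind_mono {x' y' : ℕ} (hx : x ≤ x') (hy : y ≤ y') : behind p x y ⊆ behind p x' y' := by
  rintro w (⟨i, hi, hw⟩ | ⟨hw, hz⟩)
  · exact .inl ⟨i, hi.trans hx, hw⟩
  · exact .inr ⟨hw, fun z hzl hwz => (hz z hzl hwz).trans hy⟩

theorem le_of_getVert_mem_behind (hp : p.IsPath) (hx : x ≤ p.length) {i : ℕ} (hi : i ≤ p.length)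
    (h : p.getVert i ∈ behind p x y) : i ≤ x := by
  rcases h with ⟨j, hj, hij⟩ | ⟨hoff, -⟩
  · exact (hp.getVert_injOn hi (hj.trans hx) hij).trans_le hj
  · exact (hoff (p.getVert_mem_support i)).elim

theorem exists_isPath_of_isGreatest_earEnds (h : IsGreatest (earEnds p x) b) :
    ∃ q : G.Walk (p.getVert x) (p.getVert b), q.IsPath ∧ ∀ w ∈ q.support,
      w = p.getVert x ∨ w = p.getVert b ∨
        w ∉ p.support ∧ JoinedOff G {a | a ∈ p.support} w (p.getVert b) ∧ w ∈ behind p x b := by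
  obtain ⟨q, hq, hqs⟩ :=
    h.1.2.exists_isPath (p.getVert_mem_support x) (p.getVert_mem_support b)
  refine ⟨q, hq, fun w hw => (hqs w hw).imp_right (.imp_right fun ⟨hoff, hxw, hwb⟩ => ?_)⟩
  exact ⟨hoff, hwb, .inr ⟨hoff, fun z hz hwz => h.2 ⟨hz, hxw.trans hoff hwz⟩⟩⟩

/-- There is a path of length at least `n` between positions `x` and `y` of `p` which, apart from
its end at `y`, stays behind the later ears. Together with the segment of `p` from `x` to `y` it
forms a cycle. -/
def PartialCycle (p : G.Walk u v) (x y n : ℕ) : Prop :=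
  ∃ q : G.Walk (p.getVert x) (p.getVert y), q.IsPath ∧ n ≤ q.length ∧
    ∀ w ∈ q.support, w = p.getVert y ∨ w ∈ behind p x y

theorem partialCycle_refl (p : G.Walk u v) (x : ℕ) : PartialCycle p x x 0 :=
  ⟨.nil, .nil, le_rfl, fun _ hw => .inl (Walk.mem_support_nil_iff.mp hw)⟩

theorem PartialCycle.exists_append_ear (h : PartialCycle p x y n) (hp : p.IsPath) (hxb : x < b)
    (hyb : y < b) (hb : IsGreatest (earEnds p x) b) :
    ∃ q : G.Walk (p.getVert y) (p.getVert b), q.IsPath ∧ n + 1 ≤ q.length ∧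
      ∀ w ∈ q.support, w = p.getVert y ∨ w = p.getVert b ∨ w ∈ behind p x b := by
  obtain ⟨q, hq, hqn, hqs⟩ := h
  obtain ⟨e, he, hes⟩ := exists_isPath_of_isGreatest_earEnds hb
  have hbl : b ≤ p.length := hb.1.1
  have hinter : ∀ w ∈ q.support, w ∈ e.support → w = p.getVert x := by
    intro w hwq hwe
    rcases hes w hwe with hwx | rfl | ⟨hoff, hwb, -⟩
    · exact hwx
    · rcases hqs _ hwq with hby | hb'
      · exact absurd (hp.getVert_injOn hbl (hyb.le.trans hbl) hby) hyb.ne'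
      · exact absurd (le_of_getVert_mem_behind hp (hxb.le.trans hbl) hbl hb') hxb.not_ge
    · rcases hqs w hwq with rfl | ⟨i, -, rfl⟩ | ⟨-, hz⟩
      · exact (hoff (p.getVert_mem_support y)).elim
      · exact (hoff (p.getVert_mem_support i)).elim
      · exact absurd (hz b hbl hwb) hyb.not_ge
  have hlen : 0 < e.length := by
    refine Nat.pos_of_ne_zero fun h0 => hxb.ne ?_
    exact hp.getVert_injOn (hxb.le.trans hbl) hbl (Walk.eq_of_length_eq_zero h0)
  refine ⟨q.reverse.append e, ?_, ?_, fun w hw => ?_⟩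
  · exact isPath_append_of_inter hq.reverse he fun w hw => hinter w (by simpa using hw)
  · rw [Walk.length_append, Walk.length_reverse]
    omega
  · rw [Walk.mem_support_append_iff, Walk.support_reverse, List.mem_reverse] at hw
    rcases hw with hw | hw
    · exact (hqs w hw).imp_right fun hw => .inr (behind_mono le_rfl hyb.le hw)
    · rcases hes w hw with hwx | hwb | ⟨-, -, hw⟩
      exacts [.inr (.inr (.inl ⟨x, le_rfl, hwx⟩)), .inr (.inl hwb), .inr (.inr hw)]

theorem PartialCycle.extend (h : PartialCycle p x y n) (hp : p.IsPath) (hxy : x ≤ y) (hys : y ≤ s)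
    (hsb : s < b) (hb : IsGreatest (earEnds p x) b) :
    PartialCycle p s b (n + 1 + (s - y)) := by
  have hbl : b ≤ p.length := hb.1.1
  obtain ⟨q, hq, hqn, hqs⟩ := h.exists_append_ear hp (by omega) (by omega) hb
  obtain ⟨r, hr, hrl, hrs⟩ := exists_isPath_getVert_getVert hp hys (hsb.le.trans hbl)
  have hinter : ∀ w ∈ r.support, w ∈ q.support → w = p.getVert y := by
    intro w hwr hwq
    obtain ⟨k, hyk, hks, rfl⟩ := hrs w hwr
    rcases hqs _ hwq with hky | hkb | hk
    · exact hky
    · have : k = b := hp.getVert_injOn (show k ≤ p.length by omega) hbl hkb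
      omega
    · have : k ≤ x := le_of_getVert_mem_behind hp (by omega) (by omega) hk
      rw [show k = y by omega]
  refine ⟨r.reverse.append q, ?_, ?_, fun w hw => ?_⟩
  · exact isPath_append_of_inter hr.reverse hq fun w hw => hinter w (by simpa using hw)
  · rw [Walk.length_append, Walk.length_reverse]
    omega
  · rw [Walk.mem_support_append_iff, Walk.support_reverse, List.mem_reverse] at hw
    rcases hw with hw | hw
    · obtain ⟨k, -, hks, hwk⟩ := hrs w hw
      exact .inr (.inl ⟨k, hks, hwk⟩)
    · rcases hqs w hw with hwy | hwb | hw
      exacts [.inr (.inl ⟨y, hys, hwy⟩), .inl hwb, .inr (behind_mono (by omega) le_rfl hw)]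

theorem PartialCycle.exists_isCycle (h : PartialCycle p x y n) (hp : p.IsPath) (hxy : x < y)
    (hy : y ≤ p.length) (hn : 1 < n) :
    ∃ (a : V) (q : G.Walk a a), q.IsCycle ∧ n + (y - x) ≤ q.length := by
  obtain ⟨q, hq, hqn, hqs⟩ := h
  obtain ⟨r, hr, hrl, hrs⟩ := exists_isPath_getVert_getVert hp hxy.le hy
  refine ⟨_, q.append r.reverse, isCycle_append_of_inter hq hr.reverse ?_ (.inl (by omega)), ?_⟩
  · intro w hwq hwr
    obtain ⟨k, hxk, hky, rfl⟩ := hrs w (by simpa using hwr)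
    refine (hqs _ hwq).symm.imp_left fun hk => ?_
    rw [hxk.antisymm' (le_of_getVert_mem_behind hp (hxy.le.trans hy) (hky.trans hy) hk)]
  · rw [Walk.length_append, Walk.length_reverse]
    omega

end PartialCycles

section VineCycles

namespace Vine

variable {p : G.Walk u v} {k : ℕ} (W : Vine p k) {i j t : ℕ}

/-- The length of the segment of `p` shared by the ears `t - 1` and `t`. -/
def overlap (t : ℕ) : ℕ := W.right t - W.left t

/-- The length of the segment of `p` from the end of the ear `t - 1` to the start of the ear
`t + 1`. -/
def gap (t : ℕ) : ℕ := W.left (t + 1) - W.right t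

theorem overlap_pos (ht : t ≤ W.numEars) : 0 < W.overlap t :=
  Nat.sub_pos_of_lt (W.left_lt_right t ht)

theorem left_add_sum_overlap_add_sum_gap (hm : j ≤ W.numEars) :
    W.left 0 + (∑ t ∈ Finset.range (j + 1), W.overlap t + ∑ t ∈ Finset.range j, W.gap t) =
      W.right j := by
  induction j with
  | zero => simpa [overlap] using Nat.add_sub_cancel' (W.left_lt_right 0 hm).le
  | succ j ih =>
    have hlast := ih (by omega)
    have hgap : W.right j + W.gap j = W.left (j + 1) := Nat.add_sub_cancel' (W.right_le_left j hm)
    have hoverlap : W.left (j + 1) + W.overlap (j + 1) = W.right (j + 1) :=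
      Nat.add_sub_cancel' (W.left_lt_right (j + 1) hm).le
    rw [Finset.sum_range_succ, Finset.sum_range_succ W.gap]
    omega

theorem partialCycle (hp : p.IsPath) (hij : i < j) (hj : j ≤ W.numEars) :
    PartialCycle p (W.left j) (W.right j)
      (W.overlap i + ∑ t ∈ Finset.Ico i j, (W.gap t + 1)) := by
  induction j, hij using Nat.le_induction with
  | base =>
    have hi := W.left_lt_right i (by omega)
    have hgap := W.right_le_left i hj
    have hnext := W.left_lt_right (i + 1) hj
    convert (partialCycle_refl p (W.left i)).extend hp le_rfl (hi.le.trans hgap) hnext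
      (W.isGreatest i hj) using 1
    rw [Nat.Ico_succ_singleton, Finset.sum_singleton, overlap, gap]
    omega
  | succ j hij ih =>
    have hj' := W.left_lt_right j (by omega)
    have hnext := W.left_lt_right (j + 1) hj
    convert (ih (by omega)).extend hp hj'.le (W.right_le_left j hj) hnext
      (W.isGreatest j hj) using 1
    rw [Finset.sum_Ico_succ_top (by omega), gap]
    omega

theorem exists_isCycle (hp : p.IsPath) (hij : i < j) (hj : j ≤ W.numEars) :
    ∃ (a : V) (q : G.Walk a a), q.IsCycle ∧
      W.overlap i + ∑ t ∈ Finset.Ico i j, (W.gap t + 1) + W.overlap j ≤ q.length := by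
  obtain ⟨s, rfl⟩ : ∃ s, j = s + 1 := Nat.exists_eq_succ_of_ne_zero (by omega)
  refine (W.partialCycle hp hij hj).exists_isCycle hp (W.left_lt_right _ hj)
    (W.isGreatest s hj).1.1 ?_
  have hears : 0 < ∑ t ∈ Finset.Ico i (s + 1), (W.gap t + 1) :=
    Finset.sum_pos (fun _ _ => Nat.succ_pos _) (Finset.nonempty_Ico.mpr hij)
  have := W.overlap_pos (hij.le.trans hj)
  omega

end Vine

end VineCycles

section Optimization

variable {m c : ℕ} {o g : ℕ → ℕ}

theorem sum_pairs_add_le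
    (hc : ∀ i j, i < j → j ≤ m → o i + ∑ t ∈ Finset.Ico i j, (g t + 1) + o j ≤ c) {h : ℕ}
    (h0 : 1 ≤ h) (hm : 2 * h ≤ m + 1) :
    ∑ i ∈ Finset.range h, (o i + o (m - i)) + ∑ t ∈ Finset.range m, g t + h * (m + 1) ≤
      h * c + h ^ 2 := by
  simp only [Finset.sum_add_distrib, Finset.sum_const, Nat.card_Ico, smul_eq_mul, mul_one] at hc
  induction h, h0 using Nat.le_induction with
  | base =>
    have houter := hc 0 m (by omega) le_rfl
    rw [← Finset.range_eq_Ico] at houter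
    simp only [Finset.sum_range_one, Nat.sub_zero, one_mul, one_pow] at houter ⊢
    omega
  | succ h h0 ih =>
    have hinner := ih (by omega)
    have hpair : o h + o (m - h) + m ≤ c + 2 * h := by
      have := hc h (m - h) (by omega) (by omega)
      omega
    rw [Finset.sum_range_succ]
    linarith

theorem sum_range_add_reflect {M : Type*} [AddCommMonoid M] (f : ℕ → M) {h r n : ℕ}
    (hn : 2 * h + r = n + 1) :
    ∑ i ∈ Finset.range h, (f i + f (n - i)) + ∑ i ∈ Finset.range r, f (h + i) =
      ∑ i ∈ Finset.range (n + 1), f i := by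
  have hreflect : ∑ i ∈ Finset.range h, f (n - i) = ∑ i ∈ Finset.range h, f (h + r + i) := by
    rw [← Finset.sum_range_reflect]
    refine Finset.sum_congr rfl fun i hi => congrArg f ?_
    have := Finset.mem_range.mp hi
    omega
  rw [show n + 1 = h + r + h by omega, Finset.sum_range_add, Finset.sum_range_add,
    Finset.sum_add_distrib, hreflect, add_right_comm]

theorem exists_sum_add_sq_le_mul (hm : 0 < m) (hom : 0 < o m)
    (hc : ∀ i j, i < j → j ≤ m → o i + ∑ t ∈ Finset.Ico i j, (g t + 1) + o j ≤ c) :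
    ∃ n, ∑ t ∈ Finset.range (m + 1), o t + ∑ t ∈ Finset.range m, g t + n ^ 2 ≤ n * c := by
  rcases Nat.even_or_odd' m with ⟨h, hh | hh⟩
  · have hpairs := sum_pairs_add_le hc (h := h) (by omega) (by omega)
    have hsum := sum_range_add_reflect o (h := h) (r := 1) (n := m) (by omega)
    -- The middle overlap has no partner, so it is paired with the last one.
    have hmiddle : o h + h + 1 ≤ c := by
      have hright := hc h m (by omega) le_rfl
      simp only [Finset.sum_add_distrib, Finset.sum_const, Nat.card_Ico, smul_eq_mul,
        mul_one] at hright
      omega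
    rw [Finset.sum_range_one, add_zero] at hsum
    refine ⟨h + 1, ?_⟩
    rw [← hsum]
    rw [show m + 1 = 2 * h + 1 by omega] at hpairs
    linarith
  · have hpairs := sum_pairs_add_le hc (h := h + 1) (by omega) (by omega)
    have hsum := sum_range_add_reflect o (h := h + 1) (r := 0) (n := m) (by omega)
    rw [Finset.sum_range_zero, add_zero] at hsum
    refine ⟨h + 1, ?_⟩
    rw [← hsum]
    rw [show m + 1 = 2 * (h + 1) by omega] at hpairs
    linarith

theorem four_mul_sum_le_sq (hm : 0 < m) (hom : 0 < o m)
    (hc : ∀ i j, i < j → j ≤ m → o i + ∑ t ∈ Finset.Ico i j, (g t + 1) + o j ≤ c) :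
    4 * (∑ t ∈ Finset.range (m + 1), o t + ∑ t ∈ Finset.range m, g t) ≤ c ^ 2 := by
  obtain ⟨n, hn⟩ := exists_sum_add_sq_le_mul hm hom hc
  zify at hn ⊢
  linarith [sq_nonneg ((c : ℤ) - 2 * n)]

end Optimization

theorem exists_isCycle_four_mul_length_le_sq {p : G.Walk u v} (hp : p.IsPath)
    (hconn : ∀ x, (G.induce {x}ᶜ).Preconnected) (hl : 2 ≤ p.length) :
    ∃ (w : V) (q : G.Walk w w), q.IsCycle ∧ 4 * p.length ≤ q.length ^ 2 := by
  obtain ⟨W⟩ := nonempty_vine hp hconn one_pos (one_le_two.trans hl)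
  by_contra! hshort
  have hcycle : ∀ i j, i < j → j ≤ W.numEars →
      W.overlap i + ∑ t ∈ Finset.Ico i j, (W.gap t + 1) + W.overlap j ≤
        Nat.sqrt (4 * p.length - 1) := fun i j hij hj => by
    obtain ⟨w, q, hq, hle⟩ := W.exists_isCycle hp hij hj
    exact hle.trans (Nat.le_sqrt'.mpr (Nat.le_sub_one_of_lt (hshort w q hq)))
  have hears : 0 < W.numEars := by
    by_contra! h
    have := W.right_zero.symm.trans ((congrArg W.right (by omega)).trans W.right_last)
    omega
  have hleft : W.left 0 = 0 := by
    have := W.left_lt_right 0 hears.le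
    rw [W.right_zero] at this
    omega
  have hlength := W.left_add_sum_overlap_add_sum_gap le_rfl
  rw [hleft, W.right_last, zero_add] at hlength
  have hbound := four_mul_sum_le_sq hears (W.overlap_pos le_rfl) hcycle
  rw [hlength] at hbound
  have := hbound.trans (Nat.sqrt_le' _)
  omega

section TwoConnected

theorem preconnected_compl_singleton_of_isKVertexConnected_two (hG : G.IsKVertexConnected 2)
    (x : V) : (G.induce {x}ᶜ).Preconnected := by
  have hconn := (hG.2 {x} (by simp)).preconnected
  rwa [Finset.coe_singleton] at hconn

theorem exists_adj_ne_of_isKVertexConnected_two (hG : G.IsKVertexConnected 2) (huv : u ≠ v) :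
    ∃ w, G.Adj u w ∧ w ≠ v := by
  obtain ⟨x, hxu, hxv⟩ := ENat.exists_ne_ne_of_three_le (Order.add_one_le_of_lt hG.1) u v
  have : Nontrivial ({v}ᶜ : Set V) := ⟨⟨x, hxv⟩, ⟨u, huv⟩, fun h => hxu (congrArg Subtype.val h)⟩
  obtain ⟨⟨w, hwv⟩, huw⟩ := (preconnected_compl_singleton_of_isKVertexConnected_two hG
    v).exists_adj_of_nontrivial ⟨u, huv⟩
  exact ⟨w, huw, hwv⟩

theorem exists_isPath_length_eq_two_of_isKVertexConnected_two (hG : G.IsKVertexConnected 2) :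
    ∃ (u v : V) (p : G.Walk u v), p.IsPath ∧ p.length = 2 := by
  have : Nontrivial V := (ENat.one_lt_card_iff_nontrivial V).mp <|
    (Nat.cast_lt.mpr one_lt_two).trans hG.1
  obtain ⟨v, x, hvx⟩ := exists_pair_ne V
  obtain ⟨u, hvu, -⟩ := exists_adj_ne_of_isKVertexConnected_two hG hvx
  obtain ⟨w, hvw, hwu⟩ := exists_adj_ne_of_isKVertexConnected_two hG hvu.ne
  exact ⟨u, w, .cons hvu.symm (.cons hvw .nil),
    by simp [Walk.cons_isPath_iff, hvu.ne', hvw.ne, hwu.symm], rfl⟩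

end TwoConnected

theorem mainTheorem2_general (hG : G.IsKVertexConnected 2) (p : G.Walk u v) (hp : p.IsPath) :
    ∃ (w : V) (q : G.Walk w w), q.IsCycle ∧ 2 * Real.sqrt p.length ≤ q.length := by
  obtain ⟨u', v', p', hp', hlen, hle⟩ : ∃ (u' v' : V) (p' : G.Walk u' v'),
      p'.IsPath ∧ 2 ≤ p'.length ∧ p.length ≤ p'.length := by
    rcases le_total 2 p.length with hl | hl
    · exact ⟨u, v, p, hp, hl, le_rfl⟩
    · obtain ⟨u', v', p', hp', hlen⟩ := exists_isPath_length_eq_two_of_isKVertexConnected_two hG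
      exact ⟨u', v', p', hp', hlen.ge, hl.trans hlen.ge⟩
  obtain ⟨w, q, hq, hsq⟩ := exists_isCycle_four_mul_length_le_sq hp'
    (preconnected_compl_singleton_of_isKVertexConnected_two hG) hlen
  refine ⟨w, q, hq, ?_⟩
  have hsq' : (p.length : ℝ) ≤ ((q.length : ℝ) / 2) ^ 2 := by
    have : (4 * p.length : ℝ) ≤ (q.length : ℝ) ^ 2 := by
      exact_mod_cast (Nat.mul_le_mul_left 4 hle).trans hsq
    linarith
  linarith [Real.sqrt_le_iff.mpr ⟨by positivity, hsq'⟩]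

end

theorem mainTheorem2 {V : Type*} [Finite V] (G : SimpleGraph V)
    (hG : G.IsKVertexConnected 2) :
    2 * Real.sqrt (G.longestPathLength : ℝ) ≤ (G.circumference : ℝ) := by
  have : Nonempty V := ENat.card_ne_zero_iff_nonempty V |>.mp (pos_of_gt hG.1).ne'
  obtain ⟨u, v, p, hp, hlen⟩ := G.isGreatest_longestPathLength.1
  obtain ⟨w, q, hq, hle⟩ := mainTheorem2_general hG p hp
  have hmax := (G.isGreatest_circumference fun h => h q hq).2 ⟨w, q, hq, rfl⟩
  exact hlen ▸ hle.trans (Nat.cast_le.mpr hmax)
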